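/- For a finite graph $G$ and an integer $s\ge 2$, let $\alpha_s(G)$ be the maximum number of vertices in an induced subgraph of $G$ that contains no $K_s$. For $m\ge 0$ let $\mathbf{f}_{s,s+1}(m)$ be the minimum of $\alpha_s(G)$ over all $K_{s+1}$-free graphs $G$ on $m$ vertices. For a graph $H$ and a real number $f$ let $\mathbf{RT}_s(n,H,f)$ be the maximum number of edges in an $H$-free graph $G$ on $n$ vertices with $\alpha_s(G)<f$ (and $0$ if there is no such graph). **Theorem.** Let $s\ge 2$, and let $\omega:\mathbb{N}\to\mathbb{R}$ be any function with $\omega(n)\to\infty$ as $n\to\infty$ (however slowly). Then $$\mathbf{RT}_s\bigl(n,\,K_{2s+1},\,\mathbf{f}_{s,s+1}(\lceil n/\omega(n)\rceil)\bigr)=o(n^2)\qquad (n\to\infty).$$ -/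

import Mathlib

open Filter Asymptotics

noncomputable section

/-- The `s`-independence number `α_s(G)`: the maximum number of vertices in an induced subgraph
of `G` that contains no copy of `K_s`. -/
def sIndepNum (s : ℕ) {V : Type*} [Fintype V] (G : SimpleGraph V) : ℕ :=
  sSup {k : ℕ | ∃ S : Finset V, (G.induce (S : Set V)).CliqueFree s ∧ S.card = k}

/-- The Erdős–Rogers number `f_{s,t}(n)`: the minimum `s`-independence number over all
`K_t`-free graphs of order `n`. -/
def erdosRogers (s t n : ℕ) : ℕ :=
  sInf {k : ℕ | ∃ G : SimpleGraph (Fin n), G.CliqueFree t ∧ sIndepNum s G = k}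

/-- The Ramsey–Turán number `RT_s(n, H, f)`: the maximum number of edges in an `H`-free graph `G`
of order `n` with `α_s(G) < f`, and `0` if there is no such graph (the supremum of the empty
set of natural numbers is `0`). Here `f` is the value of the threshold function at `n`. -/
def ramseyTuran (s n : ℕ) {W : Type*} (H : SimpleGraph W) (f : ℝ) : ℕ :=
  sSup {k : ℕ | ∃ G : SimpleGraph (Fin n),
    H.Free G ∧ (sIndepNum s G : ℝ) < f ∧ G.edgeSet.ncard = k}

end

/-! ### `s`-independence and Erdős–Rogers numbers -/

section IndependenceNumber

variable {V W : Type*} [Fintype V] [Fintype W] {s : ℕ}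

/-! Let `m = ⌈n / ω n⌉` and suppose `G` has more than `ε n²` edges. Dependent random choice gives a
set `U` of linear size whose `(s + 1)`-tuples all have more than `α_s(G)` common neighbours. If `|U|
≥ m`, then `α_s(G) < f_{s,s+1}(m)` puts a `K_{s+1}` inside `U`, and its common neighbourhood
contains a `K_s`: together a `K_{2s+1}`. Hence `|U| < m = o(n)`, a contradiction.

For `U` to be linear, `α_s(G)` must be polynomially smaller than `n`. This follows from
`f_{s,s+1}(m) = O(m^{2/3})`, proved by randomly colouring the points of lines in `F_q³` whose
directions lie on a conic (`exists_erdosRogers_pow_three_le`). -/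

theorem card_le_sIndepNum {G : SimpleGraph V} {S : Finset V} (h : G.CliqueFreeOn (S : Set V) s) :
    S.card ≤ sIndepNum s G := by
  refine le_csSup ⟨Fintype.card V, ?_⟩ ⟨S, (SimpleGraph.cliqueFree_induce_iff _ _ _).2 h, rfl⟩
  rintro k ⟨T, -, rfl⟩
  exact T.card_le_univ

theorem sIndepNum_le {G : SimpleGraph V} {k : ℕ}
    (h : ∀ S : Finset V, G.CliqueFreeOn (S : Set V) s → S.card ≤ k) : sIndepNum s G ≤ k := by
  refine csSup_le' ?_
  rintro _ ⟨S, hS, rfl⟩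
  exact h S ((SimpleGraph.cliqueFree_induce_iff _ _ _).1 hS)

theorem exists_isNClique_of_sIndepNum_lt {G : SimpleGraph V} {S : Finset V}
    (h : sIndepNum s G < S.card) : ∃ t ⊆ S, G.IsNClique s t := by
  by_contra! hS
  exact h.not_ge (card_le_sIndepNum fun t ht => hS t (by exact_mod_cast ht))

theorem sIndepNum_le_of_embedding {G : SimpleGraph V} {H : SimpleGraph W} (f : G ↪g H) :
    sIndepNum s G ≤ sIndepNum s H := by
  refine sIndepNum_le fun S hS => ?_
  rw [← Finset.card_map f.toEmbedding]
  refine card_le_sIndepNum fun t ht hc => ?_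
  obtain ⟨u, hu, rfl⟩ := Finset.subset_map_iff.1 (Finset.coe_subset.1 ht)
  refine hS (t := u) (by exact_mod_cast hu) ⟨fun x hx y hy hxy => ?_, by simpa using hc.2⟩
  exact f.map_rel_iff.1 (hc.1 (Finset.mem_coe.2 (Finset.mem_map_of_mem _ hx))
    (Finset.mem_coe.2 (Finset.mem_map_of_mem _ hy)) (f.injective.ne hxy))

theorem erdosRogers_le_sIndepNum {t m : ℕ} {G : SimpleGraph V} (hG : G.CliqueFree t)
    (hm : m ≤ Fintype.card V) : erdosRogers s t m ≤ sIndepNum s G := by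
  obtain ⟨f⟩ : Nonempty (Fin m ↪ V) :=
    Function.Embedding.nonempty_of_card_le (by simpa using hm)
  have e : G.comap f ↪g G := SimpleGraph.Embedding.comap f G
  have h : erdosRogers s t m ≤ sIndepNum s (G.comap f) :=
    Nat.sInf_le ⟨G.comap f, hG.comap ⟨e.toCopy⟩, rfl⟩
  exact h.trans (sIndepNum_le_of_embedding e)

/-- If `α_s(G)` is below the Erdős–Rogers number `f_{s,t}(m)`, then every set of at least `m`
vertices of `G` contains a copy of `K_t`. -/
theorem exists_isNClique_of_sIndepNum_lt_erdosRogers {t m : ℕ} {G : SimpleGraph V}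
    (hG : sIndepNum s G < erdosRogers s t m) {S : Finset V} (hm : m ≤ S.card) :
    ∃ c ⊆ S, G.IsNClique t c := by
  by_contra! hS
  refine hG.not_ge ((erdosRogers_le_sIndepNum (G := G.induce (S : Set V)) ?_ ?_).trans
    (sIndepNum_le_of_embedding (SimpleGraph.Embedding.induce _)))
  · exact (SimpleGraph.cliqueFree_induce_iff _ _ _).2 fun t ht => hS t (by exact_mod_cast ht)
  · simpa using hm

theorem ramseyTuran_le {U : Type*} {n : ℕ} {H : SimpleGraph U} {f x : ℝ} (hx : 0 ≤ x)
    (h : ∀ G : SimpleGraph (Fin n), H.Free G → (sIndepNum s G : ℝ) < f →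
      (G.edgeSet.ncard : ℝ) ≤ x) : (ramseyTuran s n H f : ℝ) ≤ x := by
  rcases Set.eq_empty_or_nonempty {k : ℕ | ∃ G : SimpleGraph (Fin n),
    H.Free G ∧ (sIndepNum s G : ℝ) < f ∧ G.edgeSet.ncard = k} with he | hne
  · rw [ramseyTuran, he]
    simpa using hx
  · have hfin : ({k : ℕ | ∃ G : SimpleGraph (Fin n),
        H.Free G ∧ (sIndepNum s G : ℝ) < f ∧ G.edgeSet.ncard = k}).Finite :=
      (Set.finite_range fun G : SimpleGraph (Fin n) => G.edgeSet.ncard).subset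
        (by rintro k ⟨G, -, -, rfl⟩; exact ⟨G, rfl⟩)
    obtain ⟨G, h1, h2, h3⟩ := Nat.sSup_mem hne hfin.bddAbove
    have := h G h1 h2
    rwa [h3] at this

end IndependenceNumber

/-! ### Upper bound for `f_{s,s+1}` from coloured lines -/

section LineColouring

variable {T V L : Type*} {s : ℕ}

/-- Given, for each slope `t`, a partition `ℓ t` of `V` into lines and a colouring `c t` of `V`,
join two points if they lie on a common line of some slope `t` and `c t` separates them. -/
def slopeGraph {C : Type*} (ℓ : T → V → L) (c : T → V → C) : SimpleGraph V where
  Adj u v := ∃ t, ℓ t u = ℓ t v ∧ c t u ≠ c t v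
  symm := ⟨fun _ _ ⟨t, h, h'⟩ => ⟨t, h.symm, h'.symm⟩⟩
  loopless := ⟨fun _ ⟨_, _, h⟩ => h rfl⟩

/-- By `hℓ` every triangle has a single slope, so a clique lies on one line, where the graph is
complete multipartite with at most `s` colour classes. -/
theorem slopeGraph_cliqueFree (hs : 2 ≤ s) {ℓ : T → V → L}
    (hℓ : ∀ u v w a b d, u ≠ v → v ≠ w → u ≠ w → ℓ a u = ℓ a v → ℓ b v = ℓ b w →
      ℓ d u = ℓ d w → a = b ∧ a = d) (c : T → V → Fin s) :
    (slopeGraph ℓ c).CliqueFree (s + 1) := by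
  classical
  rintro S ⟨hS, hcard⟩
  obtain ⟨u, hu, v, hv, huv⟩ := Finset.one_lt_card.1 (by omega : 1 < S.card)
  obtain ⟨a, ha, hca⟩ := hS hu hv huv
  have hline : ∀ w ∈ S, w ≠ u → ℓ a u = ℓ a w ∧ c a u ≠ c a w := by
    intro w hw hwu
    rcases eq_or_ne w v with rfl | hwv
    · exact ⟨ha, hca⟩
    obtain ⟨d, hd, hcd⟩ := hS hu hw hwu.symm
    obtain ⟨b, hb, -⟩ := hS hv hw hwv.symm
    obtain ⟨-, rfl⟩ := hℓ u v w a b d huv hwv.symm hwu.symm ha hb hd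
    exact ⟨hd, hcd⟩
  have hinj : Set.InjOn (c a) (S : Set V) := by
    intro x hx y hy hxy
    by_contra hne
    rcases eq_or_ne x u with rfl | hxu
    · exact (hline y hy (Ne.symm hne)).2 hxy
    rcases eq_or_ne y u with rfl | hyu
    · exact (hline x hx hne).2 hxy.symm
    obtain ⟨b, hb, hcb⟩ := hS hx hy hne
    obtain ⟨rfl, -⟩ := hℓ u x y a b a hxu.symm hne hyu.symm (hline x hx hxu).1 hb
      (hline y hy hyu).1
    exact hcb hxy
  have := Finset.card_le_card_of_injOn (t := Finset.univ) (c a) (by simp) hinj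
  simp [hcard] at this

/-- Union bound: a bad `W` misses some colour on every line. There are at most `2 ^ |V|` sets `W`
and `s ^ (|T| |L|)` choices of missing colours, and each choice has probability `((s - 1) / s) ^
(|T| w)`. -/
theorem exists_colouring_rainbow_line [Fintype T] [Fintype V] [Fintype L] (hs : 0 < s)
    (ℓ : T → V → L) {w : ℕ}
    (hw : 2 ^ Fintype.card V * s ^ (Fintype.card T * Fintype.card L) *
      (s - 1) ^ (Fintype.card T * w) < s ^ (Fintype.card T * w)) :
    ∃ c : T → V → Fin s, ∀ W : Finset V, W.card = w →
      ∃ t l, ∀ i, ∃ u ∈ W, ℓ t u = l ∧ c t u = i := by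
  classical
  have : Nonempty (Fin s) := ⟨⟨0, hs⟩⟩
  rcases lt_or_ge (Fintype.card V) w with hlt | hle
  · refine ⟨fun _ _ => Classical.arbitrary _, fun W hW => ?_⟩
    exact absurd W.card_le_univ (by omega)
  by_contra! hbad
  -- Colourings in which, for every `t` and `l`, colour `m t l` is absent from the points of `W` on
  -- that line.
  let A : Finset V → (T → L → Fin s) → Finset (T → V → Fin s) := fun W m =>
    Fintype.piFinset fun t => Fintype.piFinset fun u =>
      if u ∈ W then Finset.univ.erase (m t (ℓ t u)) else Finset.univ
  have hA : ∀ W ∈ Finset.powersetCard w (Finset.univ : Finset V), ∀ m,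
      (A W m).card = (s - 1) ^ (Fintype.card T * w) *
        s ^ (Fintype.card T * (Fintype.card V - w)) := by
    intro W hW m
    have hWc : W.card = w := (Finset.mem_powersetCard.1 hW).2
    have hu : ∀ t u, (if u ∈ W then Finset.univ.erase (m t (ℓ t u)) else Finset.univ).card =
        if u ∈ W then s - 1 else s := by
      intro t u
      split_ifs <;> simp
    simp only [A, Fintype.card_piFinset, hu, Finset.prod_ite, Finset.prod_const]
    have h1 : (Finset.univ.filter fun u => u ∈ W) = W := by ext; simp
    have h2 : (Finset.univ.filter fun u => u ∉ W) = Wᶜ := by ext; simp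
    rw [h1, h2, Finset.card_compl, hWc, Finset.card_univ, mul_pow, ← pow_mul, ← pow_mul,
      mul_comm w, mul_comm (_ - w)]
  have hcover : (Finset.univ : Finset (T → V → Fin s)) ⊆
      (Finset.powersetCard w (Finset.univ : Finset V)).biUnion fun W =>
        Finset.univ.biUnion fun m => A W m := by
    intro c _
    obtain ⟨W, hW, h⟩ := hbad c
    choose m hm using h
    simp only [Finset.mem_biUnion, Finset.mem_powersetCard_univ, Finset.mem_univ, true_and]
    refine ⟨W, hW, m, ?_⟩
    simp only [A, Fintype.mem_piFinset]
    intro t u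
    split_ifs with huW
    · simpa using hm t _ u huW rfl
    · simp
  have hcount := (Finset.card_le_card hcover).trans
    (Finset.card_biUnion_le.trans (Finset.sum_le_sum fun W hW =>
      Finset.card_biUnion_le.trans_eq (Finset.sum_congr rfl fun m _ => hA W hW m)))
  simp only [Finset.sum_const, Finset.card_univ, Fintype.card_fun, Fintype.card_fin,
    smul_eq_mul, Finset.card_powersetCard] at hcount
  have hch : (Fintype.card V).choose w ≤ 2 ^ Fintype.card V := Nat.choose_le_two_pow _ _
  have hpos : 0 < s ^ (Fintype.card T * (Fintype.card V - w)) := by positivity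
  have hsplit : (s ^ Fintype.card V) ^ Fintype.card T =
      s ^ (Fintype.card T * w) * s ^ (Fintype.card T * (Fintype.card V - w)) := by
    rw [← pow_mul, ← pow_add, ← mul_add, Nat.add_sub_cancel' hle, mul_comm]
  have hLT : (s ^ Fintype.card L) ^ Fintype.card T = s ^ (Fintype.card T * Fintype.card L) := by
    rw [← pow_mul, mul_comm]
  rw [hsplit, hLT] at hcount
  refine absurd hcount (not_le.2 ?_)
  calc _ ≤ 2 ^ Fintype.card V * (s ^ (Fintype.card T * Fintype.card L) *
        ((s - 1) ^ (Fintype.card T * w) * s ^ (Fintype.card T * (Fintype.card V - w)))) :=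
        Nat.mul_le_mul_right _ hch
    _ = 2 ^ Fintype.card V * s ^ (Fintype.card T * Fintype.card L) *
      (s - 1) ^ (Fintype.card T * w) * s ^ (Fintype.card T * (Fintype.card V - w)) := by ring
    _ < _ := Nat.mul_lt_mul_of_pos_right hw hpos

theorem sIndepNum_slopeGraph_le [Fintype V] {ℓ : T → V → L} {c : T → V → Fin s} {w : ℕ}
    (h : ∀ W : Finset V, W.card = w → ∃ t l, ∀ i, ∃ u ∈ W, ℓ t u = l ∧ c t u = i) :
    sIndepNum s (slopeGraph ℓ c) ≤ w := by
  classical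
  refine sIndepNum_le fun S hS => ?_
  by_contra! hlt
  obtain ⟨W, hWS, hW⟩ := Finset.exists_subset_card_eq hlt.le
  obtain ⟨t, l, hi⟩ := h W hW
  choose u huW hul huc using hi
  have hinj : Function.Injective u := fun i j hij => by rw [← huc i, ← huc j, hij]
  refine hS (t := Finset.univ.image u) ?_ ⟨?_, ?_⟩
  · intro x hx
    obtain ⟨i, -, rfl⟩ := Finset.mem_image.1 (Finset.mem_coe.1 hx)
    exact hWS (huW i)
  · intro x hx y hy hxy
    obtain ⟨i, -, rfl⟩ := Finset.mem_image.1 (Finset.mem_coe.1 hx)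
    obtain ⟨j, -, rfl⟩ := Finset.mem_image.1 (Finset.mem_coe.1 hy)
    refine ⟨t, by rw [hul, hul], ?_⟩
    rw [huc, huc]
    rintro rfl
    exact hxy rfl
  · simp [Finset.card_image_of_injective _ hinj]

/-- The line of direction `(1, t, t ^ 2)` through a point of the affine space `F ^ 3`,
represented by the other two coordinates of its intersection with the plane `x = 0`. -/
def curveLine {F : Type*} [Field F] (t : F) (u : F × F × F) : F × F :=
  (u.2.1 - t * u.1, u.2.2 - t ^ 2 * u.1)

/-- By Vandermonde, distinct directions `(1, t, t ^ 2)` are linearly independent in threes, so a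
triangle cannot use several slopes. -/
theorem curveLine_triangle {F : Type*} [Field F] (u v w : F × F × F) (a b d : F) (huv : u ≠ v)
    (hvw : v ≠ w) (huw : u ≠ w) (ha : curveLine a u = curveLine a v)
    (hb : curveLine b v = curveLine b w) (hd : curveLine d u = curveLine d w) :
    a = b ∧ a = d := by
  obtain ⟨x, y, z⟩ := u
  obtain ⟨x', y', z'⟩ := v
  obtain ⟨x'', y'', z''⟩ := w
  simp only [curveLine, Prod.mk.injEq] at ha hb hd
  obtain ⟨ha1, ha2⟩ := ha
  obtain ⟨hb1, hb2⟩ := hb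
  obtain ⟨hd1, hd2⟩ := hd
  have hX : x - x' ≠ 0 := by
    rintro h
    obtain rfl := sub_eq_zero.1 h
    exact huv (by simp_all)
  have hY : x' - x'' ≠ 0 := by
    rintro h
    obtain rfl := sub_eq_zero.1 h
    exact hvw (by simp_all)
  have hZ : x - x'' ≠ 0 := by
    rintro h
    obtain rfl := sub_eq_zero.1 h
    exact huw (by simp_all)
  have h1 : (a - d) * (x - x') = (d - b) * (x' - x'') := by linear_combination hd1 - ha1 - hb1
  have h2 : (a - b) * ((a - d) * (x - x')) = 0 := by
    linear_combination hd2 - ha2 - hb2 - (b + d) * (hd1 - ha1 - hb1)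
  rcases mul_eq_zero.1 h2 with h | h
  · obtain rfl := sub_eq_zero.1 h
    have : (a - d) * (x - x'') = 0 := by linear_combination h1
    exact ⟨rfl, sub_eq_zero.1 ((mul_eq_zero.1 this).resolve_right hZ)⟩
  · obtain rfl := sub_eq_zero.1 ((mul_eq_zero.1 h).resolve_right hX)
    rw [h] at h1
    exact ⟨sub_eq_zero.1 ((mul_eq_zero.1 h1.symm).resolve_right hY), rfl⟩

theorem exists_mul_pow_pred_lt_pow (hs : 0 < s) : ∃ C : ℕ, 2 * s * (s - 1) ^ C < s ^ C := by
  have hs' : (0 : ℝ) < s := by exact_mod_cast hs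
  obtain ⟨C, hC⟩ := exists_pow_lt_of_lt_one (x := 1 / (2 * s : ℝ)) (y := ((s : ℝ) - 1) / s)
    (by positivity) (by rw [div_lt_one hs']; linarith)
  refine ⟨C, ?_⟩
  rw [div_pow, div_lt_div_iff₀ (by positivity) (by positivity)] at hC
  have : ((2 * s * (s - 1) ^ C : ℕ) : ℝ) < ((s ^ C : ℕ) : ℝ) := by
    push_cast [Nat.cast_sub hs]
    linarith
  exact_mod_cast this

theorem erdosRogers_cube_le_of_prime (hs : 2 ≤ s) :
    ∃ C : ℕ, ∀ q : ℕ, q.Prime → ∀ m ≤ q ^ 3, erdosRogers s (s + 1) m ≤ C * q ^ 2 := by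
  obtain ⟨C, hC⟩ := exists_mul_pow_pred_lt_pow (by omega : 0 < s)
  refine ⟨C, fun q hq m hm => ?_⟩
  have : Fact q.Prime := ⟨hq⟩
  have hcard : Fintype.card (ZMod q × ZMod q × ZMod q) = q ^ 3 := by
    simp only [Fintype.card_prod, ZMod.card]; ring
  obtain ⟨c, hc⟩ := exists_colouring_rainbow_line (s := s) (by omega)
    -- Here `|V| = |T| |L| = q ^ 3` and `|T| w = C q ^ 3`, so the condition is the `q ^ 3`-th power
    -- of `hC`.
    (curveLine (F := ZMod q)) (w := C * q ^ 2) (by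
      have h := Nat.pow_lt_pow_left hC (pow_ne_zero 3 hq.ne_zero)
      rw [hcard, Fintype.card_prod, ZMod.card]
      calc _ = (2 * s * (s - 1) ^ C) ^ q ^ 3 := by
            rw [mul_pow, mul_pow, ← pow_mul]; ring_nf
        _ < _ := h
        _ = _ := by rw [← pow_mul]; ring_nf)
  exact (erdosRogers_le_sIndepNum (slopeGraph_cliqueFree hs curveLine_triangle c)
    (hcard ▸ hm)).trans (sIndepNum_slopeGraph_le hc)

/-- The Erdős–Rogers function `f_{s,s+1}` satisfies `f_{s,s+1}(m) = O(m ^ (2 / 3))`. -/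
theorem exists_erdosRogers_pow_three_le (hs : 2 ≤ s) :
    ∃ K : ℕ, ∀ m ≠ 0, erdosRogers s (s + 1) m ^ 3 ≤ K * m ^ 2 := by
  obtain ⟨C, hC⟩ := erdosRogers_cube_le_of_prime hs
  -- One factor 8 of 64 comes from rounding `m` up to a cube, the other from Bertrand's postulate.
  refine ⟨C ^ 3 * 64 ^ 2, fun m hm => ?_⟩
  have hex : ∃ k, m ≤ k ^ 3 := ⟨m, Nat.le_self_pow (by norm_num) m⟩
  obtain ⟨k, hk, hkmin⟩ : ∃ k, m ≤ k ^ 3 ∧ ∀ j < k, j ^ 3 < m :=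
    ⟨Nat.find hex, Nat.find_spec hex, fun j hj => not_le.1 (Nat.find_min hex hj)⟩
  have hk0 : k ≠ 0 := by rintro rfl; simp at hk; omega
  obtain ⟨q, hq, hkq, hqk⟩ := Nat.exists_prime_lt_and_le_two_mul k hk0
  have hkm : k ^ 3 ≤ 8 * m := by
    obtain ⟨j, rfl⟩ := Nat.exists_eq_succ_of_ne_zero hk0
    have := hkmin j (by omega)
    rcases Nat.eq_zero_or_pos j with rfl | hj
    · simp; omega
    · calc (j + 1) ^ 3 ≤ (2 * j) ^ 3 := Nat.pow_le_pow_left (by omega) 3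
        _ = 8 * j ^ 3 := by ring
        _ ≤ 8 * m := by omega
  have hqm : q ^ 3 ≤ 64 * m := by
    calc q ^ 3 ≤ (2 * k) ^ 3 := Nat.pow_le_pow_left hqk 3
      _ = 8 * k ^ 3 := by ring
      _ ≤ 64 * m := by omega
  calc erdosRogers s (s + 1) m ^ 3 ≤ (C * q ^ 2) ^ 3 :=
        Nat.pow_le_pow_left (hC q hq m (hk.trans (Nat.pow_le_pow_left hkq.le 3))) 3
    _ = C ^ 3 * (q ^ 3) ^ 2 := by ring
    _ ≤ C ^ 3 * (64 * m) ^ 2 := by gcongr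
    _ = C ^ 3 * 64 ^ 2 * m ^ 2 := by ring

end LineColouring

/-! ### Dependent random choice -/

section DependentRandomChoice

open Finset in
/-- **Dependent random choice**: a graph of density `ε` has a large vertex set in which all
`(r + 1)`-tuples have more than `β` common neighbours. -/
theorem exists_finset_forall_lt_card_common_neighbors {V : Type*} [Fintype V] [Nonempty V]
    (G : SimpleGraph V) [DecidableRel G.Adj] {ε : ℝ} (hε : 0 ≤ ε)
    (hdeg : ε * (Fintype.card V : ℝ) ^ 2 ≤ ∑ v, (G.degree v : ℝ)) (r t β : ℕ) :
    ∃ U : Finset V,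
      ε ^ (t + 1) * Fintype.card V -
        (Fintype.card V : ℝ) ^ (r + 1) * β ^ (t + 1) / (Fintype.card V : ℝ) ^ (t + 1) ≤ #U ∧
      ∀ R : Fin (r + 1) → V, (∀ i, R i ∈ U) → β < #{v | ∀ i, G.Adj (R i) v} := by
  classical
  set n := Fintype.card V with hn
  have hn0 : (0 : ℝ) < n := by exact_mod_cast Fintype.card_pos
  let N : (Fin (t + 1) → V) → Finset V := fun τ => {v | ∀ j, G.Adj v (τ j)}
  let D : (Fin (r + 1) → V) → Finset V := fun R => {v | ∀ i, G.Adj (R i) v}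
  -- Bad tuples: too few common neighbours, yet contained in the common neighbourhood of the sample
  -- `τ`.
  let B : (Fin (t + 1) → V) → Finset (Fin (r + 1) → V) := fun τ =>
    {R | #(D R) ≤ β ∧ ∀ i, R i ∈ N τ}
  have hcount : ∀ A : Finset V, #{τ : Fin (t + 1) → V | ∀ j, τ j ∈ A} = #A ^ (t + 1) := by
    intro A
    rw [← Fintype.card_piFinset_const A (t + 1)]
    congr 1
    ext τ
    simp
  have hN : ∑ τ, #(N τ) = ∑ v, G.degree v ^ (t + 1) := by
    simp only [N, card_filter]
    rw [sum_comm]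
    refine sum_congr rfl fun v _ => ?_
    rw [← card_filter, ← G.card_neighborFinset_eq_degree, ← hcount]
    simp
  have hB : ∑ τ, #(B τ) ≤ n ^ (r + 1) * β ^ (t + 1) := by
    simp only [B, card_filter]
    rw [sum_comm]
    calc _ ≤ ∑ _R : Fin (r + 1) → V, β ^ (t + 1) := by
          refine sum_le_sum fun R _ => ?_
          rw [← card_filter]
          by_cases hR : #(D R) ≤ β
          · refine le_trans (le_of_eq ?_) (Nat.pow_le_pow_left hR (t + 1))
            rw [← hcount]
            congr 1
            ext τ
            simp only [N, D, hR, mem_filter, mem_univ, true_and]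
            exact forall_comm
          · simp [hR]
      _ = _ := by simp [hn]
  have hpow : ε ^ (t + 1) * n * (n : ℝ) ^ (t + 1) ≤ ∑ v, (G.degree v : ℝ) ^ (t + 1) := by
    refine le_trans ?_ (pow_sum_div_card_le_sum_pow (s := univ) (f := fun v => (G.degree v : ℝ)) (by simp) t)
    rw [card_univ, ← hn, le_div_iff₀ (by positivity)]
    calc _ = (ε * (n : ℝ) ^ 2) ^ (t + 1) := by ring
      _ ≤ _ := pow_le_pow_left₀ (by positivity) hdeg _
  obtain ⟨τ, -, hτ⟩ := exists_le_of_sum_le (s := (univ : Finset (Fin (t + 1) → V)))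
    (f := fun _ => ε ^ (t + 1) * n - (n : ℝ) ^ (r + 1) * β ^ (t + 1) / (n : ℝ) ^ (t + 1))
    (g := fun τ => (#(N τ) : ℝ) - #(B τ)) univ_nonempty (by
      have hN' : ∑ τ, (#(N τ) : ℝ) = ∑ v, (G.degree v : ℝ) ^ (t + 1) := by exact_mod_cast hN
      have hB' : ∑ τ, (#(B τ) : ℝ) ≤ (n : ℝ) ^ (r + 1) * β ^ (t + 1) := by exact_mod_cast hB
      rw [sum_const, card_univ, nsmul_eq_mul, sum_sub_distrib, hN']
      simp only [Fintype.card_fun, Fintype.card_fin, ← hn]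
      push_cast
      rw [mul_sub, mul_div_cancel₀ _ (by positivity)]
      linarith)
  -- Deleting one entry of each bad tuple destroys them all.
  refine ⟨N τ \ (B τ).image fun R => R 0, hτ.trans ?_, fun R hR => ?_⟩
  · have h1 := le_card_sdiff ((B τ).image fun R => R 0) (N τ)
    have h2 : #((B τ).image fun R => R 0) ≤ #(B τ) := card_image_le
    have h3 : #(N τ) ≤ #(N τ \ (B τ).image fun R => R 0) + #(B τ) := by omega
    rw [sub_le_iff_le_add]
    exact_mod_cast h3
  · by_contra! hβ
    refine (mem_sdiff.1 (hR 0)).2 (mem_image.2 ⟨R, ?_, rfl⟩)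
    simp only [B, mem_filter, mem_univ, true_and]
    exact ⟨hβ, fun i => (mem_sdiff.1 (hR i)).1⟩

end DependentRandomChoice

/-! ### Building `K_{2s+1}` and the main theorem -/

theorem SimpleGraph.IsNClique.union {V : Type*} [DecidableEq V] {G : SimpleGraph V} {a b : ℕ}
    {S T : Finset V} (hS : G.IsNClique a S) (hT : G.IsNClique b T)
    (h : ∀ x ∈ S, ∀ y ∈ T, G.Adj x y) : G.IsNClique (a + b) (S ∪ T) := by
  refine ⟨fun x hx y hy hxy => ?_, ?_⟩
  · rcases Finset.mem_union.1 (Finset.mem_coe.1 hx) with hx | hx <;>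
      rcases Finset.mem_union.1 (Finset.mem_coe.1 hy) with hy | hy
    · exact hS.1 hx hy hxy
    · exact h x hx y hy
    · exact (h y hy x hx).symm
    · exact hT.1 hx hy hxy
  · rw [Finset.card_union_of_disjoint, hS.2, hT.2]
    exact Finset.disjoint_left.2 fun x hx hx' => G.loopless.irrefl x (h x hx x hx')

/-- In a `K_{2s+1}`-free graph with `α_s(G) < f_{s,s+1}(m)`, a vertex set all of whose
`(s + 1)`-tuples have more than `α_s(G)` common neighbours has fewer than `m` elements. -/
theorem card_lt_of_cliqueFree_of_sIndepNum_lt {V : Type*} [Fintype V] {G : SimpleGraph V}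
    {s m : ℕ} (hG : G.CliqueFree (2 * s + 1)) (hα : sIndepNum s G < erdosRogers s (s + 1) m)
    {U : Finset V}
    (hU : ∀ R : Fin (s + 1) → V, (∀ i, R i ∈ U) →
      ∃ D : Finset V, sIndepNum s G < D.card ∧ ∀ v ∈ D, ∀ i, G.Adj (R i) v) :
    U.card < m := by
  classical
  by_contra! hm
  obtain ⟨S, hSU, hS⟩ := exists_isNClique_of_sIndepNum_lt_erdosRogers hα hm
  obtain ⟨D, hD, hadj⟩ := hU (fun i => (S.equivFinOfCardEq hS.2).symm i)
    fun i => hSU ((S.equivFinOfCardEq hS.2).symm i).2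
  obtain ⟨T, hTD, hT⟩ := exists_isNClique_of_sIndepNum_lt hD
  refine hG (S ∪ T) ?_
  have := hS.union hT fun x hx y hy => by
    simpa using hadj y (hTD hy) (S.equivFinOfCardEq hS.2 ⟨x, hx⟩)
  rwa [show s + 1 + s = 2 * s + 1 by ring] at this

theorem card_lt_of_le_card_edgeSet {V : Type*} [Fintype V] [Nonempty V] {G : SimpleGraph V}
    {s m K : ℕ} {ε : ℝ} (hε : 0 ≤ ε) (hG : G.CliqueFree (2 * s + 1))
    (hα : sIndepNum s G < erdosRogers s (s + 1) m)
    (hK : erdosRogers s (s + 1) m ^ 3 ≤ K * Fintype.card V ^ 2)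
    (hedge : ε * (Fintype.card V : ℝ) ^ 2 ≤ G.edgeSet.ncard) :
    ε ^ (3 * (s + 1)) * Fintype.card V - (K : ℝ) ^ (s + 1) < m := by
  classical
  set n := Fintype.card V with hn
  have hn0 : (0 : ℝ) < n := by exact_mod_cast Fintype.card_pos
  obtain ⟨U, hU, hR⟩ := exists_finset_forall_lt_card_common_neighbors G hε (by
    have h := G.sum_degrees_eq_twice_card_edges
    have h' : (G.edgeFinset.card : ℝ) = G.edgeSet.ncard := by
      rw [← G.coe_edgeFinset, Set.ncard_coe_finset]
    have h'' : ∑ v, (G.degree v : ℝ) = 2 * G.edgeFinset.card := by exact_mod_cast h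
    rw [h'', h']
    refine hedge.trans ?_
    -- With `3 (s + 1)` samples the error term is `(α_s(G) ^ 3 / n ^ 2) ^ (s + 1)`, which `hK`
    -- bounds by a constant.
    linarith [(Nat.cast_nonneg G.edgeSet.ncard : (0 : ℝ) ≤ _)]) s (3 * s + 2) (sIndepNum s G)
  have hlt := card_lt_of_cliqueFree_of_sIndepNum_lt hG hα fun R hRU =>
    ⟨_, hR R hRU, fun v hv => by simpa using hv⟩
  have hβ : (sIndepNum s G : ℝ) ^ 3 ≤ K * (n : ℝ) ^ 2 := by
    exact_mod_cast (Nat.pow_le_pow_left hα.le 3).trans hK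
  have hpow : (n : ℝ) ^ (s + 1) * (sIndepNum s G : ℝ) ^ (3 * (s + 1)) / (n : ℝ) ^ (3 * (s + 1)) ≤
      (K : ℝ) ^ (s + 1) := by
    rw [div_le_iff₀ (by positivity), pow_mul, pow_mul, ← mul_pow, ← mul_pow]
    refine pow_le_pow_left₀ (by positivity) ?_ _
    calc (n : ℝ) * (sIndepNum s G : ℝ) ^ 3 ≤ n * (K * (n : ℝ) ^ 2) := by gcongr
      _ = _ := by ring
  have hlt' : (U.card : ℝ) < m := by exact_mod_cast hlt
  rw [show 3 * s + 2 + 1 = 3 * (s + 1) by ring, ← hn] at hU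
  linarith

theorem theorem7p1 (s : ℕ) (hs : 2 ≤ s) (ω : ℕ → ℝ) (hω : Tendsto ω atTop atTop) :
    (fun n : ℕ => (ramseyTuran s n (⊤ : SimpleGraph (Fin (2 * s + 1)))
        (erdosRogers s (s + 1) ⌈(n : ℝ) / ω n⌉₊ : ℝ) : ℝ))
      =o[atTop] (fun n : ℕ => (n : ℝ) ^ 2) := by
  obtain ⟨K, hK⟩ := exists_erdosRogers_pow_three_le hs
  refine isLittleO_iff.2 fun ε hε => ?_
  set δ := ε ^ (3 * (s + 1)) with hδ
  have hδ0 : 0 < δ := by positivity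
  -- `ω n ≥ 1` gives `m ≤ n`; the bounds by `2 / δ` and on `n` make `n / ω n` and `K ^ (s + 1) + 1`
  -- each at most `δ n / 2`.
  filter_upwards [hω.eventually_ge_atTop 1, hω.eventually_ge_atTop (2 / δ), eventually_ge_atTop 1,
    tendsto_natCast_atTop_atTop.eventually_ge_atTop (2 * ((K : ℝ) ^ (s + 1) + 1) / δ)]
    with n hω1 hωδ hn1 hnK
  rw [Real.norm_of_nonneg (by positivity), Real.norm_of_nonneg (by positivity)]
  refine ramseyTuran_le (by positivity) fun G hG hα => ?_
  by_contra! hedge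
  have hn0 : (0 : ℝ) < n := by exact_mod_cast hn1
  have : Nonempty (Fin n) := ⟨⟨0, hn1⟩⟩
  have hω0 : 0 < ω n := by linarith
  have hm0 : ⌈(n : ℝ) / ω n⌉₊ ≠ 0 := (Nat.ceil_pos.2 (by positivity)).ne'
  have hmn : ⌈(n : ℝ) / ω n⌉₊ ≤ n := Nat.ceil_le.2 (div_le_self hn0.le hω1)
  have hfree : G.CliqueFree (2 * s + 1) := by
    rw [SimpleGraph.cliqueFree_iff]
    exact not_nonempty_iff.1 hG
  have hlt := card_lt_of_le_card_edgeSet hε.le hfree (by exact_mod_cast hα)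
    (K := K) (by
      rw [Fintype.card_fin]
      exact (hK _ hm0).trans (Nat.mul_le_mul_left _ (Nat.pow_le_pow_left hmn 2)))
    (by rw [Fintype.card_fin]; exact hedge.le)
  rw [Fintype.card_fin, ← hδ] at hlt
  have hceil : (⌈(n : ℝ) / ω n⌉₊ : ℝ) < n / ω n + 1 := Nat.ceil_lt_add_one (by positivity)
  have hhalf : (n : ℝ) / ω n ≤ δ * n / 2 := by
    rw [div_le_iff₀ hδ0] at hωδ
    rw [div_le_iff₀ hω0]
    nlinarith
  rw [div_le_iff₀ hδ0] at hnK
  linarith
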